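/- Let $G$ be a finite simple graph with vertex set $V$, $|V| = n \ge 1$, and let $\overline{G}$ be its complement. An \emph{orthonormal representation} of $G$ is a map $f : V \to \mathbb{R}^d$, for some $d$, such that $\|f(v)\| = 1$ for all $v \in V$ and $\langle f(u), f(v)\rangle = 0$ for all distinct non-adjacent $u, v \in V$. Its \emph{Gram matrix} is $M_f = (\langle f(u), f(v)\rangle)_{u,v \in V}$. Let $L(G)$ be the maximum of $\bigl\| \sum_{v \in V} f(v) \bigr\|$ over all orthonormal representations $f$ of $G$ (in all dimensions $d$), and let the Lovász theta function $\vartheta(G)$ be the maximum, over all orthonormal representations $f$ of the complement $\overline{G}$ (in all dimensions $d$), of the largest eigenvalue of $M_f$. (Both maxima are attained.) Then $$\frac{n}{\sqrt{\vartheta(G)}} \;\le\; L(G) \;\le\; \sqrt{n\,\vartheta(\overline{G})}.$$ Moreover, if $G$ is vertex-transitive (that is, for all $u, v \in V$ some automorphism of $G$ maps $u$ to $v$), then $L(G) = \sqrt{n\,\vartheta(\overline{G})}$. -/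

import Mathlib

namespace SimpleGraph

open Matrix

/-- `f` is an orthonormal representation of `G`: the vectors `f v` are unit vectors, and distinct
non-adjacent vertices receive orthogonal vectors. -/
def IsOrthonormalRep {V : Type*} (G : SimpleGraph V) {d : ℕ}
    (f : V → EuclideanSpace ℝ (Fin d)) : Prop :=
  (∀ v, ‖f v‖ = 1) ∧ ∀ u v, u ≠ v → ¬ G.Adj u v → inner ℝ (f u) (f v) = 0

/-- The lengths of the sums `∑ v, f v`, over all orthonormal representations `f` of `G`
(in `ℝ ^ d`, for any `d`). -/
def repSumNorms {V : Type*} [Fintype V] (G : SimpleGraph V) : Set ℝ :=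
  {r | ∃ (d : ℕ) (f : V → EuclideanSpace ℝ (Fin d)),
    G.IsOrthonormalRep f ∧ r = ‖∑ v, f v‖}

/-- `L(G)`: the maximum length of the sum of the vectors of an orthonormal representation of `G`.
The maximum is attained, see `isGreatest_maxRepSumNorm`. -/
noncomputable def maxRepSumNorm {V : Type*} [Fintype V] (G : SimpleGraph V) : ℝ :=
  sSup G.repSumNorms

/-- `r` is the largest (real) eigenvalue of the real square matrix `M`. -/
def IsLargestEigenvalue {V : Type*} [Fintype V] (M : Matrix V V ℝ) (r : ℝ) : Prop :=
  IsGreatest {c : ℝ | Module.End.HasEigenvalue M.mulVecLin c} r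

/-- The largest eigenvalues of the Gram matrices of the orthonormal representations of the
complement of `G` (in `ℝ ^ d`, for any `d`). -/
def coRepLargestEigenvalues {V : Type*} [Fintype V] (G : SimpleGraph V) : Set ℝ :=
  {r | ∃ (d : ℕ) (f : V → EuclideanSpace ℝ (Fin d)),
    Gᶜ.IsOrthonormalRep f ∧ IsLargestEigenvalue (Matrix.gram ℝ f) r}

/-- The Lovász theta function of `G`: the maximum, over all orthonormal representations `f` of
the complement of `G`, of the largest eigenvalue of the Gram matrix of `f`.
The maximum is attained if `G` has a vertex, see `isGreatest_lovaszTheta`. -/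
noncomputable def lovaszTheta {V : Type*} [Fintype V] (G : SimpleGraph V) : ℝ :=
  sSup G.coRepLargestEigenvalues

/-- `G` is vertex-transitive: its automorphism group acts transitively on the vertices. -/
def IsVertexTransitive {V : Type*} (G : SimpleGraph V) : Prop :=
  ∀ u v : V, ∃ φ : G ≃g G, φ u = v

/-! ### The two maxima are attained -/

section Attained

variable {V : Type*} [Fintype V]

open scoped MatrixOrder Matrix.Norms.L2Operator in
theorem exists_gram_eq_of_posSemidef (M : Matrix V V ℝ) (hM : M.PosSemidef) :
    ∃ f : V → EuclideanSpace ℝ (Fin (Fintype.card V)), Matrix.gram ℝ f = M := by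
  classical
  obtain ⟨B, rfl⟩ := CStarAlgebra.nonneg_iff_eq_star_mul_self.mp hM.nonneg
  let e := Fintype.equivFin V
  refine ⟨fun v => WithLp.toLp 2 fun i => B (e.symm i) v, ?_⟩
  ext u v
  simp only [Matrix.gram_apply, PiLp.inner_apply, Matrix.mul_apply, Matrix.star_apply]
  rw [← e.symm.sum_comp]
  simp [mul_comm]

theorem isOrthonormalRep_iff_gram {V : Type*} {G : SimpleGraph V} {d : ℕ}
    {f : V → EuclideanSpace ℝ (Fin d)} :
    G.IsOrthonormalRep f ↔ (∀ v, Matrix.gram ℝ f v v = 1) ∧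
      ∀ u v, u ≠ v → ¬ G.Adj u v → Matrix.gram ℝ f u v = 0 := by
  simp only [IsOrthonormalRep, Matrix.gram_apply, real_inner_self_eq_norm_sq]
  simp [pow_eq_one_iff_of_nonneg]

theorem norm_sum_smul_sq {d : ℕ} (f : V → EuclideanSpace ℝ (Fin d)) (x : V → ℝ) :
    ‖∑ v, x v • f v‖ ^ 2 = x ⬝ᵥ (Matrix.gram ℝ f *ᵥ x) := by
  rw [← real_inner_self_eq_norm_sq, ← Matrix.star_dotProduct_gram_mulVec]
  simp

/-- Every orthonormal representation can be moved to dimension `|V|` without changing its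
Gram matrix. -/
theorem exists_rep_card {G : SimpleGraph V} {d : ℕ} {f : V → EuclideanSpace ℝ (Fin d)}
    (hf : G.IsOrthonormalRep f) :
    ∃ g : V → EuclideanSpace ℝ (Fin (Fintype.card V)),
      G.IsOrthonormalRep g ∧ Matrix.gram ℝ g = Matrix.gram ℝ f := by
  obtain ⟨g, hg⟩ := exists_gram_eq_of_posSemidef _ (Matrix.posSemidef_gram ℝ f)
  refine ⟨g, ?_, hg⟩
  rw [isOrthonormalRep_iff_gram] at hf ⊢
  rwa [hg]

theorem exists_rep (G : SimpleGraph V) :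
    ∃ f : V → EuclideanSpace ℝ (Fin (Fintype.card V)), G.IsOrthonormalRep f := by
  classical
  obtain ⟨f, hf⟩ := exists_gram_eq_of_posSemidef (1 : Matrix V V ℝ) Matrix.PosSemidef.one
  refine ⟨f, isOrthonormalRep_iff_gram.2 ?_⟩
  rw [hf]
  exact ⟨fun v => Matrix.one_apply_eq v, fun u v h _ => Matrix.one_apply_ne h⟩

theorem isCompact_reps (G : SimpleGraph V) (d : ℕ) :
    IsCompact {f : V → EuclideanSpace ℝ (Fin d) | G.IsOrthonormalRep f} := by
  refine Metric.isCompact_of_isClosed_isBounded ?_ ?_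
  · simp only [IsOrthonormalRep, Set.ofPred_and, Set.ofPred_forall]
    refine IsClosed.inter (isClosed_iInter fun v => isClosed_eq (by fun_prop) (by fun_prop)) ?_
    exact isClosed_iInter fun u => isClosed_iInter fun v => isClosed_iInter fun _ =>
      isClosed_iInter fun _ => isClosed_eq (by fun_prop) (by fun_prop)
  · refine (Metric.isBounded_closedBall (x := 0) (r := 1)).subset fun f hf => ?_
    rw [mem_closedBall_zero_iff, pi_norm_le_iff_of_nonneg zero_le_one]
    exact fun v => (hf.1 v).le

theorem isGreatest_maxRepSumNorm (G : SimpleGraph V) :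
    IsGreatest G.repSumNorms G.maxRepSumNorm := by
  obtain ⟨f, hf, hmax⟩ := (G.isCompact_reps (Fintype.card V)).exists_isMaxOn G.exists_rep
    (f := fun f => ‖∑ v, f v‖) (by fun_prop)
  have h : IsGreatest G.repSumNorms ‖∑ v, f v‖ := by
    refine ⟨⟨_, f, hf, rfl⟩, ?_⟩
    rintro _ ⟨d, g, hg, rfl⟩
    obtain ⟨g', hg', hgram⟩ := exists_rep_card hg
    have h1 := norm_sum_smul_sq g 1
    have h2 := norm_sum_smul_sq g' 1
    rw [hgram, ← h1] at h2
    simp only [Pi.one_apply, one_smul] at h2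
    rw [← (pow_left_inj₀ (norm_nonneg _) (norm_nonneg _) two_ne_zero).1 h2]
    exact hmax hg'
  rw [maxRepSumNorm, h.csSup_eq]
  exact h

theorem isGreatest_lovaszTheta [Nonempty V] (G : SimpleGraph V) :
    IsGreatest G.coRepLargestEigenvalues G.lovaszTheta := by
  classical
  let S : Set ((V → EuclideanSpace ℝ (Fin (Fintype.card V))) × EuclideanSpace ℝ V) :=
    {f | Gᶜ.IsOrthonormalRep f} ×ˢ Metric.sphere 0 1
  have hS : IsCompact S := (Gᶜ.isCompact_reps _).prod (isCompact_sphere 0 1)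
  have hne : S.Nonempty := by
    obtain ⟨f, hf⟩ := Gᶜ.exists_rep
    obtain ⟨v⟩ := ‹Nonempty V›
    exact ⟨(f, EuclideanSpace.single v 1), hf, by simp⟩
  obtain ⟨⟨f, x⟩, ⟨hf, hx⟩, hmax⟩ := hS.exists_isMaxOn hne
    (f := fun p => ‖∑ v, p.2 v • p.1 v‖ ^ 2) (by fun_prop)
  simp only [Set.mem_ofPred_eq] at hf
  set m : ℝ := ‖∑ v, x v • f v‖ ^ 2 with hm
  have hxx : (x : V → ℝ) ⬝ᵥ x = 1 := by
    have : ‖x‖ ^ 2 = 1 := by rw [mem_sphere_zero_iff_norm.1 hx]; norm_num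
    rw [EuclideanSpace.real_norm_sq_eq] at this
    simpa [dotProduct, sq] using this
  -- the Rayleigh quotient of any representation is at most `m`
  have hray : ∀ g : V → EuclideanSpace ℝ (Fin (Fintype.card V)), Gᶜ.IsOrthonormalRep g →
      ∀ y : V → ℝ, y ⬝ᵥ (Matrix.gram ℝ g *ᵥ y) ≤ m * (y ⬝ᵥ y) := by
    intro g hg y
    rcases eq_or_ne y 0 with rfl | hy
    · simp
    have hy' : WithLp.toLp 2 y ≠ 0 := by simpa using hy
    have hn : 0 < ‖WithLp.toLp 2 y‖ := norm_pos_iff.2 hy'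
    have hyy : ‖WithLp.toLp 2 y‖ ^ 2 = y ⬝ᵥ y := by
      rw [EuclideanSpace.real_norm_sq_eq]
      simp [dotProduct, sq]
    have h := hmax (show (g, ‖WithLp.toLp 2 y‖⁻¹ • WithLp.toLp 2 y) ∈ S from
      ⟨hg, by simp [norm_smul, hn.ne']⟩)
    simp only [Set.mem_ofPred_eq, PiLp.smul_apply, smul_eq_mul, mul_smul,
      ← Finset.smul_sum, norm_smul, mul_pow, norm_inv, norm_norm] at h
    rw [norm_sum_smul_sq, inv_pow, inv_mul_le_iff₀ (by positivity), hyy, mul_comm] at h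
    exact h
  have hle : ∀ g : V → EuclideanSpace ℝ (Fin (Fintype.card V)), Gᶜ.IsOrthonormalRep g →
      ∀ c, Module.End.HasEigenvalue (Matrix.gram ℝ g).mulVecLin c → c ≤ m := by
    intro g hg c hc
    obtain ⟨y, hy⟩ := hc.exists_hasEigenvector
    have h := hray g hg y
    have h1 : Matrix.gram ℝ g *ᵥ y = c • y := by simpa using hy.apply_eq_smul
    rw [h1, dotProduct_smul, smul_eq_mul] at h
    have hpos : 0 < y ⬝ᵥ y := by
      have := (Matrix.dotProduct_star_self_pos_iff (v := y)).2 hy.2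
      simpa using this
    exact le_of_mul_le_mul_right h hpos
  have hpsd : (m • (1 : Matrix V V ℝ) - Matrix.gram ℝ f).PosSemidef := by
    refine .of_dotProduct_mulVec_nonneg ?_ fun y => ?_
    · exact (Matrix.isHermitian_one.smul (by simp [IsSelfAdjoint])).sub
        (Matrix.isHermitian_gram ℝ f)
    · have := hray f hf y
      simp only [Matrix.sub_mulVec, Matrix.smul_mulVec, Matrix.one_mulVec, dotProduct_sub,
        dotProduct_smul, smul_eq_mul, star_trivial]
      linarith
  have heig : Matrix.gram ℝ f *ᵥ x = m • (x : V → ℝ) := by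
    have h0 := (hpsd.dotProduct_mulVec_zero_iff x).1 (by
      simp only [Matrix.sub_mulVec, Matrix.smul_mulVec, Matrix.one_mulVec, dotProduct_sub,
        dotProduct_smul, smul_eq_mul, star_trivial, hxx]
      rw [← norm_sum_smul_sq, ← hm]
      ring)
    simp only [Matrix.sub_mulVec, Matrix.smul_mulVec, Matrix.one_mulVec] at h0
    exact (sub_eq_zero.1 h0).symm
  have h : IsGreatest G.coRepLargestEigenvalues m := by
    refine ⟨⟨_, f, hf, ?_, fun c hc => hle f hf c hc⟩, ?_⟩
    · refine Module.End.hasEigenvalue_of_hasEigenvector (x := (x : V → ℝ)) ⟨?_, ?_⟩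
      · exact Module.End.mem_eigenspace_iff.2 (by simpa using heig)
      · intro h0
        rw [h0] at hxx
        simp at hxx
    · rintro r ⟨d, g, hg, hr⟩
      obtain ⟨g', hg', hgram⟩ := exists_rep_card hg
      exact hle g' hg' r (by rw [hgram]; exact hr.1)
  rw [lovaszTheta, h.csSup_eq]
  exact h

end Attained

end SimpleGraph

namespace SimpleGraph

open Matrix

variable {V : Type*} [Fintype V]

/-! Gram matrices of representations of `G` are the positive semidefinite matrices with unit
diagonal that vanish at non-edges, and `L(G) ^ 2` is the maximal entry sum of such a matrix. The
upper bound is the Rayleigh quotient at the all-ones vector. Under vertex-transitivity, an optimal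
Gram matrix for `ϑ(Gᶜ)` is weighted by its top eigenvector and averaged over automorphisms, which
turns the Rayleigh quotient into an entry sum. The lower bound is semidefinite duality
(`ones_mem_closure_dominatedForms`): up to closure, the all-ones form is dominated by some `A` of
trace `L(G) ^ 2` vanishing at edges. Such an `A` has entry sum at least `n ^ 2`, while rescaling its
diagonal to `1` bounds that sum by `ϑ(G)` times the trace (`sum_le_lovaszTheta_mul_trace`). Hence `n
^ 2 ≤ ϑ(G) * L(G) ^ 2`. -/

open scoped MatrixOrder Matrix.Norms.L2Operator in
theorem exists_isLargestEigenvalue [Nonempty V] {M : Matrix V V ℝ} (hM : M.IsHermitian) :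
    ∃ r, IsLargestEigenvalue M r ∧ ∀ x, x ⬝ᵥ (M *ᵥ x) ≤ r * (x ⬝ᵥ x) := by
  classical
  have hspec : {c : ℝ | Module.End.HasEigenvalue M.mulVecLin c} = Set.range hM.eigenvalues := by
    ext c
    rw [← hM.spectrum_real_eq_range_eigenvalues, ← Matrix.spectrum_toLin', Set.mem_ofPred_eq,
      Module.End.hasEigenvalue_iff_mem_spectrum, Matrix.toLin'_apply']
  obtain ⟨i, hi⟩ := Finite.exists_max hM.eigenvalues
  refine ⟨hM.eigenvalues i, ?_, fun x => ?_⟩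
  · rw [IsLargestEigenvalue, hspec]
    refine ⟨⟨i, rfl⟩, ?_⟩
    rintro _ ⟨j, rfl⟩
    exact hi j
  · have hle : M ≤ algebraMap ℝ _ (hM.eigenvalues i) := by
      refine le_algebraMap_of_spectrum_le (fun c hc => ?_) hM
      rw [hM.spectrum_real_eq_range_eigenvalues] at hc
      obtain ⟨j, rfl⟩ := hc
      exact hi j
    have h := (Matrix.le_iff.1 hle).dotProduct_mulVec_nonneg x
    simpa [Matrix.sub_mulVec, Algebra.algebraMap_eq_smul_one, Matrix.smul_mulVec] using h

/-! ### Rayleigh quotients, entry sums and the upper bound -/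

theorem gram_rayleigh_le_lovaszTheta [Nonempty V] {G : SimpleGraph V} {d : ℕ}
    {f : V → EuclideanSpace ℝ (Fin d)} (hf : Gᶜ.IsOrthonormalRep f) (x : V → ℝ) :
    x ⬝ᵥ (Matrix.gram ℝ f *ᵥ x) ≤ G.lovaszTheta * (x ⬝ᵥ x) := by
  obtain ⟨r, hr, hx⟩ := exists_isLargestEigenvalue (Matrix.isHermitian_gram ℝ f)
  refine (hx x).trans (mul_le_mul_of_nonneg_right ?_ ?_)
  · exact G.isGreatest_lovaszTheta.2 ⟨d, f, hf, hr⟩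
  · simpa using dotProduct_star_self_nonneg x

theorem rayleigh_le_lovaszTheta [Nonempty V] {G : SimpleGraph V} {M : Matrix V V ℝ}
    (hM : M.PosSemidef) (hdiag : ∀ v, M v v = 1) (hadj : ∀ u v, G.Adj u v → M u v = 0)
    (x : V → ℝ) : x ⬝ᵥ (M *ᵥ x) ≤ G.lovaszTheta * (x ⬝ᵥ x) := by
  obtain ⟨f, rfl⟩ := exists_gram_eq_of_posSemidef M hM
  refine gram_rayleigh_le_lovaszTheta (isOrthonormalRep_iff_gram.2 ⟨hdiag, fun u v huv h => ?_⟩) x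
  exact hadj u v (by simpa [huv] using h)

theorem maxRepSumNorm_nonneg (G : SimpleGraph V) : 0 ≤ G.maxRepSumNorm := by
  obtain ⟨d, f, -, h⟩ := G.isGreatest_maxRepSumNorm.1
  exact h ▸ norm_nonneg _

theorem sum_gram_eq_norm_sq {d : ℕ} (f : V → EuclideanSpace ℝ (Fin d)) :
    ∑ u, ∑ v, Matrix.gram ℝ f u v = ‖∑ v, f v‖ ^ 2 := by
  have h := norm_sum_smul_sq f 1
  simp only [Pi.one_apply, one_smul] at h
  simp [h, dotProduct, Matrix.mulVec]

/-- The sum of the entries of a normalized positive semidefinite matrix vanishing at the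
non-edges of `G` is at most `L(G) ^ 2`. -/
theorem sum_le_maxRepSumNorm_sq {G : SimpleGraph V} {M : Matrix V V ℝ}
    (hM : M.PosSemidef) (hdiag : ∀ v, M v v = 1) (hadj : ∀ u v, u ≠ v → ¬ G.Adj u v → M u v = 0) :
    ∑ u, ∑ v, M u v ≤ G.maxRepSumNorm ^ 2 := by
  obtain ⟨f, rfl⟩ := exists_gram_eq_of_posSemidef M hM
  rw [sum_gram_eq_norm_sq]
  have := G.isGreatest_maxRepSumNorm.2 ⟨_, f, isOrthonormalRep_iff_gram.2 ⟨hdiag, hadj⟩, rfl⟩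
  gcongr

theorem maxRepSumNorm_sq_le [Nonempty V] (G : SimpleGraph V) :
    G.maxRepSumNorm ^ 2 ≤ (Fintype.card V : ℝ) * Gᶜ.lovaszTheta := by
  obtain ⟨d, f, hf, h⟩ := G.isGreatest_maxRepSumNorm.1
  have h1 := gram_rayleigh_le_lovaszTheta (G := Gᶜ) (f := f) (by rwa [compl_compl]) 1
  rw [← norm_sum_smul_sq] at h1
  simp only [Pi.one_apply, one_smul, one_dotProduct_one] at h1
  rw [h]
  linarith

/-- A form of the maximality of `ϑ(G)` for matrices whose diagonal need not be constant; the proof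
scales the diagonal to `1`. -/
theorem sum_le_lovaszTheta_mul_trace [Nonempty V] {G : SimpleGraph V} {A : Matrix V V ℝ}
    (hA : A.PosSemidef) (hpos : ∀ v, 0 < A v v) (hadj : ∀ u v, G.Adj u v → A u v = 0) :
    ∑ u, ∑ v, A u v ≤ G.lovaszTheta * A.trace := by
  classical
  let D : Matrix V V ℝ := Matrix.diagonal fun v => (√(A v v))⁻¹
  have hB : (Dᴴ * A * D).PosSemidef := hA.conjTranspose_mul_mul_same D
  have happ : ∀ u v, (Dᴴ * A * D) u v = (√(A u u))⁻¹ * A u v * (√(A v v))⁻¹ := by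
    intro u v
    simp [D, Matrix.mul_diagonal, Matrix.diagonal_mul]
  have hs : ∀ v, √(A v v) ≠ 0 := fun v => (Real.sqrt_pos.2 (hpos v)).ne'
  -- The test vector `√(A v v)` undoes the scaling in the quadratic form, and its squared length is
  -- the trace.
  have h := rayleigh_le_lovaszTheta (G := G) hB
    (fun v => by
      rw [happ]
      have := hs v
      field_simp
      rw [Real.sq_sqrt (hpos v).le])
    (fun u v huv => by rw [happ, hadj u v huv]; simp) (fun v => √(A v v))
  have h1 : (fun v => √(A v v)) ⬝ᵥ (Dᴴ * A * D) *ᵥ (fun v => √(A v v)) = ∑ u, ∑ v, A u v := by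
    simp only [dotProduct, Matrix.mulVec, happ, Finset.mul_sum]
    refine Finset.sum_congr rfl fun u _ => Finset.sum_congr rfl fun v _ => ?_
    have := hs u
    have := hs v
    field_simp
  have h2 : (fun v => √(A v v)) ⬝ᵥ (fun v => √(A v v)) = A.trace := by
    simp [dotProduct, Matrix.trace, Real.mul_self_sqrt (hpos _).le]
  rwa [h1, h2] at h

/-! ### Equality for vertex-transitive graphs -/

/-- Averaging an optimal representation over the automorphism group. -/
theorem IsVertexTransitive.card_mul_lovaszTheta_le [Nonempty V] {G : SimpleGraph V}
    (hG : G.IsVertexTransitive) :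
    (Fintype.card V : ℝ) * Gᶜ.lovaszTheta ≤ G.maxRepSumNorm ^ 2 := by
  classical
  obtain ⟨d, f, hf, hr, -⟩ := Gᶜ.isGreatest_lovaszTheta.1
  rw [compl_compl] at hf
  obtain ⟨hdiag, hadj⟩ := isOrthonormalRep_iff_gram.1 hf
  have hM := Matrix.posSemidef_gram ℝ f
  set M := Matrix.gram ℝ f
  obtain ⟨x, hx⟩ := hr.exists_hasEigenvector
  have hMx : M *ᵥ x = Gᶜ.lovaszTheta • x := by simpa using hx.apply_eq_smul
  have hxx : 0 < x ⬝ᵥ x := by simpa using (Matrix.dotProduct_star_self_pos_iff (v := x)).2 hx.2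
  have : Finite (G ≃g G) := DFunLike.finite _
  cases nonempty_fintype (G ≃g G)
  -- Substitute `φ ↦ φ * ψ`, where `ψ` maps `v` to `u`.
  have horb : ∀ u v, ∑ φ : G ≃g G, x (φ u) * x (φ u) = ∑ φ : G ≃g G, x (φ v) * x (φ v) := by
    intro u v
    obtain ⟨ψ, rfl⟩ := hG v u
    exact Equiv.sum_comp (Equiv.mulRight ψ) (fun φ : G ≃g G => x (φ v) * x (φ v))
  have hinv : ∀ (φ : G ≃g G) (g : V → ℝ), ∑ v, g (φ v) = ∑ v, g v :=
    fun φ g => φ.toEquiv.sum_comp g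
  obtain ⟨w⟩ := ‹Nonempty V›
  set c := ∑ φ : G ≃g G, x (φ w) * x (φ w) with hc
  have hnc : (Fintype.card V : ℝ) * c = (Fintype.card (G ≃g G) : ℝ) * (x ⬝ᵥ x) := by
    calc (Fintype.card V : ℝ) * c = ∑ v, ∑ φ : G ≃g G, x (φ v) * x (φ v) := by
          simp [horb _ w, ← hc]
      _ = ∑ φ : G ≃g G, ∑ v, x (φ v) * x (φ v) := Finset.sum_comm
      _ = _ := by simp [fun φ : G ≃g G => hinv φ fun v => x v * x v, dotProduct]
  have hn : (0 : ℝ) < Fintype.card V := by exact_mod_cast Fintype.card_pos_iff.2 ⟨w⟩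
  have hcard : (0 : ℝ) < Fintype.card (G ≃g G) := by exact_mod_cast Fintype.card_pos_iff.2 ⟨1⟩
  have hc0 : 0 < c := by
    have : 0 < (Fintype.card V : ℝ) * c := hnc ▸ mul_pos hcard hxx
    exact pos_of_mul_pos_right this hn.le
  -- The entries of `Dᴴ * M * D` sum to `x ⬝ᵥ M *ᵥ x`, but its diagonal `x v ^ 2` need not be
  -- constant; summing over automorphisms makes it constantly `c`.
  let D : Matrix V V ℝ := Matrix.diagonal x
  let N : Matrix V V ℝ := c⁻¹ • ∑ φ : G ≃g G, (Dᴴ * M * D).submatrix φ φ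
  have hN : ∀ u v, N u v = c⁻¹ * ∑ φ : G ≃g G, x (φ u) * M (φ u) (φ v) * x (φ v) := by
    intro u v
    simp [N, D, Matrix.sum_apply, Matrix.mul_diagonal, Matrix.diagonal_mul]
  have hNpsd : N.PosSemidef :=
    (Matrix.posSemidef_sum Finset.univ fun (φ : G ≃g G) _ =>
      (hM.conjTranspose_mul_mul_same D).submatrix φ).smul (inv_nonneg.2 hc0.le)
  have h := sum_le_maxRepSumNorm_sq (G := G) hNpsd
    (fun v => by
      simp only [hN, hdiag, mul_one]
      rw [horb v w, ← hc, inv_mul_cancel₀ hc0.ne'])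
    (fun u v huv hnadj => by
      rw [hN, Finset.sum_eq_zero, mul_zero]
      intro φ _
      rw [hadj _ _ (φ.injective.ne huv) (by rwa [φ.map_adj_iff])]
      ring)
  refine le_trans (le_of_eq ?_) h
  have hsum : ∑ u, ∑ v, N u v = c⁻¹ * (Fintype.card (G ≃g G) * (x ⬝ᵥ M *ᵥ x)) := by
    simp only [hN, ← Finset.mul_sum]
    congr 1
    calc _ = ∑ φ : G ≃g G, ∑ u, ∑ v, x (φ u) * M (φ u) (φ v) * x (φ v) := by
          refine Eq.trans ?_ Finset.sum_comm
          exact Finset.sum_congr rfl fun u _ => Finset.sum_comm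
      _ = ∑ φ : G ≃g G, (x ⬝ᵥ M *ᵥ x) := by
          refine Finset.sum_congr rfl fun φ _ => ?_
          rw [← hinv φ.symm]
          simp only [RelIso.apply_symm_apply, dotProduct, Matrix.mulVec, Finset.mul_sum, ← mul_assoc]
          exact Finset.sum_congr rfl fun u _ => hinv φ fun v => x u * M u v * x v
      _ = _ := by simp
  rw [hsum, hMx, dotProduct_smul, smul_eq_mul, mul_left_comm (Fintype.card (G ≃g G) : ℝ), ← hnc]
  field_simp

/-! ### Semidefinite duality -/

/-- The matrices dominated, as quadratic forms, by a symmetric matrix of trace `t` vanishing at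
the edges of `G`. -/
def dominatedForms (G : SimpleGraph V) (t : ℝ) : Set (V → V → ℝ) :=
  {X | ∃ A : Matrix V V ℝ, A.IsSymm ∧ (∀ u v, G.Adj u v → A u v = 0) ∧ A.trace = t ∧
    ∀ x, x ⬝ᵥ (Matrix.of X *ᵥ x) ≤ x ⬝ᵥ (A *ᵥ x)}

/-- Serves both convexity (`a + b = 1`, equal traces) and recession directions (`t = 0`, `b`
arbitrarily large). -/
theorem add_smul_mem_dominatedForms {G : SimpleGraph V} {s t a b : ℝ} {X Y : V → V → ℝ}
    (hX : X ∈ G.dominatedForms s) (hY : Y ∈ G.dominatedForms t) (ha : 0 ≤ a) (hb : 0 ≤ b) :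
    a • X + b • Y ∈ G.dominatedForms (a * s + b * t) := by
  obtain ⟨A, hA, hA0, hAt, hAX⟩ := hX
  obtain ⟨B, hB, hB0, hBt, hBY⟩ := hY
  refine ⟨a • A + b • B, (hA.smul a).add (hB.smul b), fun u v h => ?_, ?_, fun x => ?_⟩
  · simp [hA0 u v h, hB0 u v h]
  · simp [hAt, hBt]
  · have h : Matrix.of (a • X + b • Y) = a • Matrix.of X + b • Matrix.of Y := rfl
    rw [h]
    simp only [Matrix.add_mulVec, Matrix.smul_mulVec, dotProduct_add, dotProduct_smul, smul_eq_mul]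
    have := hAX x
    have := hBY x
    gcongr

theorem convex_dominatedForms (G : SimpleGraph V) (t : ℝ) : Convex ℝ (G.dominatedForms t) := by
  intro X hX Y hY a b ha hb hab
  have := add_smul_mem_dominatedForms hX hY ha hb
  rwa [← add_mul, hab, one_mul] at this

theorem of_mem_dominatedForms {G : SimpleGraph V} {A : Matrix V V ℝ} (hA : A.IsSymm)
    (hadj : ∀ u v, G.Adj u v → A u v = 0) :
    (fun u v => A u v) ∈ G.dominatedForms A.trace :=
  ⟨A, hA, hadj, rfl, fun _ => le_rfl⟩

/-- `M` may be non-symmetric: antisymmetric matrices, whose form is zero, later force symmetry of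
the separating functional. -/
theorem mem_dominatedForms_zero {G : SimpleGraph V} {M : Matrix V V ℝ}
    (hM : ∀ x, x ⬝ᵥ (M *ᵥ x) ≤ 0) : (fun u v => M u v) ∈ G.dominatedForms 0 :=
  ⟨0, by simp [Matrix.IsSymm], by simp, by simp, fun x => by simpa using! hM x⟩

theorem apply_eq_sum_single [DecidableEq V] (φ : (V → V → ℝ) →L[ℝ] ℝ) (X : V → V → ℝ) :
    φ X = ∑ u, ∑ v, φ (fun i j => Matrix.single u v (1 : ℝ) i j) * X u v := by
  have h : X = ∑ u, ∑ v, X u v • fun i j => Matrix.single u v (1 : ℝ) i j := by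
    ext i j
    simp [Finset.sum_apply, Matrix.single_apply, ite_and]
  conv_lhs => rw [h]
  simp [mul_comm]

/-- Strong duality: up to closure, the all-ones matrix is dominated by a symmetric matrix of trace
`L(G) ^ 2` vanishing at the edges of `G`. A separating functional would be a positive semidefinite
matrix contradicting the maximality of `L(G)`. -/
theorem ones_mem_closure_dominatedForms [Nonempty V] (G : SimpleGraph V) :
    (fun _ _ => 1 : V → V → ℝ) ∈ closure (G.dominatedForms (G.maxRepSumNorm ^ 2)) := by
  classical
  by_contra hJ
  set t := G.maxRepSumNorm ^ 2 with ht
  obtain ⟨φ, r, hφ, hr⟩ := geometric_hahn_banach_closed_point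
    (convex_dominatedForms G t).closure isClosed_closure hJ
  replace hφ : ∀ X ∈ G.dominatedForms t, φ X < r := fun X hX => hφ X (subset_closure hX)
  have hcard : (0 : ℝ) < Fintype.card V := by exact_mod_cast Fintype.card_pos
  -- The scalar matrix of trace `t` is the base point for recession directions; its value under `φ`
  -- also yields `hlt`.
  have hbase : (fun u v => ((t / Fintype.card V) • (1 : Matrix V V ℝ)) u v) ∈
      G.dominatedForms t := by
    have := of_mem_dominatedForms (G := G) (A := (t / Fintype.card V) • (1 : Matrix V V ℝ))
      (Matrix.isSymm_one.smul _) (fun u v h => by simp [h.ne])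
    rwa [Matrix.trace_smul, Matrix.trace_one, smul_eq_mul, div_mul_cancel₀ _ hcard.ne'] at this
  -- the functional is nonpositive on the recession cone
  have hrec : ∀ X ∈ G.dominatedForms 0, φ X ≤ 0 := by
    intro X hX
    by_contra! hpos
    obtain ⟨k, hk⟩ := exists_nat_gt ((r - φ fun u v => ((t / Fintype.card V) • (1 : Matrix V V ℝ)) u v) / φ X)
    have hmem := add_smul_mem_dominatedForms hbase hX zero_le_one k.cast_nonneg
    rw [one_mul, mul_zero, add_zero, one_smul] at hmem
    have h := hφ _ hmem
    rw [div_lt_iff₀ hpos] at hk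
    rw [map_add, map_smul, smul_eq_mul] at h
    linarith
  let Z : Matrix V V ℝ := Matrix.of fun u v => φ fun i j => Matrix.single u v (1 : ℝ) i j
  have hZ : ∀ X, φ X = ∑ u, ∑ v, Z u v * X u v := apply_eq_sum_single φ
  have hZs : ∀ X : Matrix V V ℝ, φ (fun i j => X i j) = ∑ u, ∑ v, Z u v * X u v := fun X => hZ _
  have hsingle : ∀ u v : V, ∑ i, ∑ j, Z i j * Matrix.single u v (1 : ℝ) i j = Z u v := by
    intro u v
    simp [Matrix.single_apply, ite_and]
  have hsymm_le : ∀ u v, Z u v ≤ Z v u := by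
    intro u v
    have h := hrec _ (mem_dominatedForms_zero
      (M := Matrix.single u v (1 : ℝ) - Matrix.single v u 1) fun x => by
        have hd : ∀ (i : V) (c : ℝ), x ⬝ᵥ Function.update 0 i c = x i * c :=
          fun i c => dotProduct_single x c i
        simp [Matrix.sub_mulVec, Matrix.single_mulVec, hd, mul_comm])
    rw [hZs] at h
    simp only [Matrix.sub_apply, mul_sub, Finset.sum_sub_distrib, hsingle] at h
    linarith
  have hsymm : ∀ u v, Z u v = Z v u := fun u v => (hsymm_le u v).antisymm (hsymm_le v u)
  have hnonadj : ∀ u v, u ≠ v → ¬ G.Adj u v → Z u v = 0 := by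
    intro u v huv hnadj
    -- At a non-edge the dominating matrix is free, so both signs of `c` give recession directions.
    have h : ∀ c : ℝ, c * (Z u v + Z v u) ≤ 0 := by
      intro c
      have hmem := of_mem_dominatedForms (G := G)
        (A := c • (Matrix.single u v (1 : ℝ) + Matrix.single v u 1))
        (by
          refine Matrix.IsSymm.smul ?_ c
          simp [Matrix.IsSymm, add_comm])
        (fun i j hij => by
          have h1 : ¬ (u = i ∧ v = j) := by rintro ⟨rfl, rfl⟩; exact hnadj hij
          have h2 : ¬ (v = i ∧ u = j) := by rintro ⟨rfl, rfl⟩; exact hnadj hij.symm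
          simp [h1, h2])
      have htr : (c • (Matrix.single u v (1 : ℝ) + Matrix.single v u 1)).trace = 0 := by
        simp [Matrix.trace_single_eq_of_ne _ _ _ huv, Matrix.trace_single_eq_of_ne _ _ _ huv.symm]
      rw [htr] at hmem
      have h := hrec _ hmem
      rw [hZs] at h
      simp only [Matrix.smul_apply, Matrix.add_apply, smul_eq_mul, mul_left_comm _ c, mul_add,
        Finset.sum_add_distrib, ← Finset.mul_sum, hsingle] at h
      rwa [mul_add]
    have h1 := h 1
    have h2 := h (-1)
    have h3 := hsymm u v
    linarith
  have hdiag_le : ∀ u v, Z u u ≤ Z v v := by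
    intro u v
    have hmem := of_mem_dominatedForms (G := G)
      (A := Matrix.single u u (1 : ℝ) - Matrix.single v v 1)
      (by simp [Matrix.IsSymm])
      (fun i j hij => by
        have h1 : ¬ (u = i ∧ u = j) := by rintro ⟨rfl, rfl⟩; exact hij.ne rfl
        have h2 : ¬ (v = i ∧ v = j) := by rintro ⟨rfl, rfl⟩; exact hij.ne rfl
        simp [h1, h2])
    rw [Matrix.trace_sub, Matrix.trace_single_eq_same, Matrix.trace_single_eq_same, sub_self]
      at hmem
    have h := hrec _ hmem
    rw [hZs] at h
    simp only [Matrix.sub_apply, mul_sub, Finset.sum_sub_distrib, hsingle] at h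
    linarith
  have hpsd : Z.PosSemidef := by
    refine .of_dotProduct_mulVec_nonneg (by ext u v; simp [hsymm u v]) fun x => ?_
    have h := hrec _ (mem_dominatedForms_zero (M := -Matrix.vecMulVec x x) fun y => by
      simpa [Matrix.neg_mulVec, Matrix.vecMulVec_mulVec, dotProduct_comm y x] using
        mul_self_nonneg (x ⬝ᵥ y))
    rw [hZs] at h
    simp only [Matrix.neg_apply, Matrix.vecMulVec_apply] at h
    have h2 : x ⬝ᵥ Z *ᵥ x = -∑ u, ∑ v, Z u v * -(x u * x v) := by
      simp only [dotProduct, Matrix.mulVec, Finset.mul_sum, ← Finset.sum_neg_distrib]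
      exact Finset.sum_congr rfl fun i _ => Finset.sum_congr rfl fun j _ => by ring
    rw [star_trivial, h2]
    linarith
  obtain ⟨w⟩ := ‹Nonempty V›
  have hdiag : ∀ v, Z v v = Z w w := fun v => (hdiag_le v w).antisymm (hdiag_le w v)
  have hlt : t * Z w w < ∑ u, ∑ v, Z u v := by
    have h1 := hφ _ hbase
    rw [hZs] at h1
    rw [hZ] at hr
    simp only [mul_one] at hr
    refine lt_of_le_of_lt (le_of_eq ?_) (h1.trans hr)
    simp [Matrix.one_apply, hdiag]
    field_simp
  -- A zero diagonal forces `Z = 0`, against the strict separation; otherwise `Z` divided by its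
  -- diagonal value beats `L(G) ^ 2`.
  rcases (hpsd.diag_nonneg (i := w)).eq_or_lt with h0 | h0
  · have hZ0 : Z = 0 := hpsd.trace_eq_zero_iff.1 (by simp [Matrix.trace, hdiag, ← h0])
    simp [hZ0] at hlt
  · have h := sum_le_maxRepSumNorm_sq (G := G) (hpsd.smul (inv_nonneg.2 h0.le))
      (fun v => by simp [hdiag v, h0.ne'])
      (fun u v huv hnadj => by simp [hnonadj u v huv hnadj])
    simp only [Matrix.smul_apply, smul_eq_mul, ← Finset.mul_sum] at h
    rw [inv_mul_le_iff₀ h0, ← ht] at h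
    linarith

/-- Duality holds only up to closure: an entrywise error `ε` costs at most `ε * (∑ |x v|) ^ 2 ≤ ε *
n * (x ⬝ᵥ x)`, which adding `ε * n` to the diagonal of `A` absorbs. The trace grows by `ε * n ^ 2`,
and `ε → 0`. -/
theorem card_sq_le [Nonempty V] (G : SimpleGraph V) :
    (Fintype.card V : ℝ) ^ 2 ≤ G.lovaszTheta * G.maxRepSumNorm ^ 2 := by
  classical
  set n : ℝ := (Fintype.card V : ℝ) with hn
  have hcard : 0 < n := by rw [hn]; exact_mod_cast Fintype.card_pos
  have key : ∀ ε > 0, n ^ 2 ≤ G.lovaszTheta * (G.maxRepSumNorm ^ 2 + ε * n * n) := by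
    intro ε hε
    obtain ⟨X, ⟨A, hA, hadj, htr, hdom⟩, hX⟩ :=
      Metric.mem_closure_iff.1 G.ones_mem_closure_dominatedForms ε hε
    have hclose : ∀ u v, |X u v - 1| ≤ ε := by
      intro u v
      have h1 : Dist.dist (1 : ℝ) (X u v) < ε :=
        ((dist_le_pi_dist (fun _ : V => (1 : ℝ)) (X u) v).trans
          (dist_le_pi_dist (fun _ _ => (1 : ℝ)) X u)).trans_lt hX
      rw [Real.dist_eq, abs_sub_comm] at h1
      exact h1.le
    have hquad : ∀ x : V → ℝ, (∑ v, x v) ^ 2 ≤ x ⬝ᵥ ((A + (ε * n) • (1 : Matrix V V ℝ)) *ᵥ x) := by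
      intro x
      have h1 : (∑ v, x v) ^ 2 - x ⬝ᵥ (Matrix.of X *ᵥ x) ≤ ε * (∑ v, |x v|) ^ 2 := by
        rw [sq, sq, Finset.sum_mul_sum, Finset.sum_mul_sum]
        simp only [dotProduct, Matrix.mulVec, Matrix.of_apply, Finset.mul_sum,
          ← Finset.sum_sub_distrib]
        refine Finset.sum_le_sum fun u _ => Finset.sum_le_sum fun v _ => ?_
        calc x u * x v - x u * (X u v * x v) ≤ |(X u v - 1) * (x u * x v)| := by
              rw [← abs_neg]
              exact le_trans (le_of_eq (by ring)) (le_abs_self _)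
          _ = |X u v - 1| * (|x u| * |x v|) := by rw [abs_mul, abs_mul]
          _ ≤ ε * (|x u| * |x v|) := by gcongr; exact hclose u v
      have h2 : (∑ v, |x v|) ^ 2 ≤ n * (x ⬝ᵥ x) := by
        have := sq_sum_le_card_mul_sum_sq (s := Finset.univ) (f := fun v => |x v|)
        simpa [dotProduct, sq, hn] using this
      have h3 := hdom x
      have h4 := mul_le_mul_of_nonneg_left h2 hε.le
      simp only [Matrix.add_mulVec, Matrix.smul_mulVec, Matrix.one_mulVec, dotProduct_add,
        dotProduct_smul, smul_eq_mul]
      linarith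
    set B := A + (ε * n) • (1 : Matrix V V ℝ) with hB
    have hBpsd : B.PosSemidef := by
      refine .of_dotProduct_mulVec_nonneg ?_ fun x => ?_
      · have : B.IsSymm := hA.add (Matrix.isSymm_one.smul _)
        rwa [Matrix.IsHermitian, Matrix.conjTranspose_eq_transpose_of_trivial]
      · rw [star_trivial]
        exact (sq_nonneg _).trans (hquad x)
    -- Domination at a basis vector gives `1 ≤ B v v`, so the diagonal can be rescaled.
    have hBpos : ∀ v, 0 < B v v := fun v => by
      have := hquad (Pi.single v 1)
      simp at this
      linarith
    have h := sum_le_lovaszTheta_mul_trace (G := G) hBpsd hBpos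
      (fun u v huv => by simp [hB, hadj u v huv, huv.ne])
    have h1 := hquad 1
    have h2 : (1 : V → ℝ) ⬝ᵥ (B *ᵥ 1) = ∑ u, ∑ v, B u v := by
      simp [dotProduct, Matrix.mulVec]
    have h3 : B.trace = G.maxRepSumNorm ^ 2 + ε * n * n := by
      simp [hB, htr, hn]
    rw [h2] at h1
    rw [h3] at h
    simp only [Pi.one_apply, Finset.sum_const, Finset.card_univ, nsmul_eq_mul, mul_one] at h1
    exact h1.trans h
  have hlim : Filter.Tendsto (fun ε : ℝ => G.lovaszTheta * (G.maxRepSumNorm ^ 2 + ε * n * n))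
      (nhdsWithin 0 (Set.Ioi 0)) (nhds (G.lovaszTheta * (G.maxRepSumNorm ^ 2 + 0 * n * n))) :=
    (Continuous.tendsto (by fun_prop) 0).mono_left nhdsWithin_le_nhds
  have := ge_of_tendsto hlim (eventually_nhdsWithin_of_forall key)
  simpa using this

end SimpleGraph

theorem mainTheorem10 {V : Type*} [Fintype V] [Nonempty V] (G : SimpleGraph V) :
    (Fintype.card V : ℝ) / Real.sqrt G.lovaszTheta ≤ G.maxRepSumNorm ∧
      G.maxRepSumNorm ≤ Real.sqrt ((Fintype.card V : ℝ) * Gᶜ.lovaszTheta) ∧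
      (G.IsVertexTransitive →
        G.maxRepSumNorm = Real.sqrt ((Fintype.card V : ℝ) * Gᶜ.lovaszTheta)) := by
  have hL := G.maxRepSumNorm_nonneg
  have hupper := Real.le_sqrt_of_sq_le G.maxRepSumNorm_sq_le
  refine ⟨div_le_of_le_mul₀ (Real.sqrt_nonneg _) hL ?_, hupper, fun hG => hupper.antisymm ?_⟩
  · calc (Fintype.card V : ℝ) ≤ √(G.lovaszTheta * G.maxRepSumNorm ^ 2) :=
          Real.le_sqrt_of_sq_le G.card_sq_le
      _ = G.maxRepSumNorm * √G.lovaszTheta := by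
          rw [Real.sqrt_mul' _ (sq_nonneg _), Real.sqrt_sq hL, mul_comm]
  · exact (Real.sqrt_le_left hL).2 hG.card_mul_lovaszTheta_le
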